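/- Let $(X,d)$ be a complete length space (that is, $d(x,y)$ is the infimum of the lengths of continuous curves joining $x$ and $y$), let $\Omega\subset X$ be open, and let $B_\delta(x)$ denote open balls. Let $H:\Omega\times\mathbb R\times[0,\infty)\to\mathbb R$ be continuous and assume: (1) for every $x_0\in\Omega$ and $\rho_0\in\mathbb R$ there are $\delta>0$ and a modulus of continuity $\omega$ such that $|H(x_1,\rho_1,p)-H(x_2,\rho_2,p)|\le\omega(d(x_1,x_2)+|\rho_1-\rho_2|)$ for all $x_1,x_2\in B_\delta(x_0)\cap\Omega$, $\rho_1,\rho_2\in[\rho_0-\delta,\rho_0+\delta]$ and $p\ge0$; (2) for every $x_0\in\Omega$ and $\rho_0\in\mathbb R$ there are $\delta>0$ and $\lambda_0>0$ such that $p\mapsto H(x,\rho,p)-\lambda_0p$ is nondecreasing on $[0,\infty)$ for every $x\in B_\delta(x_0)\cap\Omega$ and $\rho\in[\rho_0-\delta,\rho_0+\delta]$; (3) for every $R>0$, $\inf_{(x,\rho)\in\Omega\times[-R,R]}H(x,\rho,p)\to\infty$ as $p\to\infty$. For a locally Lipschitz function $u$ on $\Omega$ write $$|\nabla u|(x)=\limsup_{y\to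 x}\frac{|u(y)-u(x)|}{d(x,y)},\qquad |\nabla^{\pm}u|(x)=\limsup_{y\to x}\frac{[u(y)-u(x)]_{\pm}}{d(x,y)},\qquad |\nabla u|^*(x)=\limsup_{y\to x}|\nabla u|(y),$$ where $[a]_+=\max\{a,0\}$ and $[a]_-=\max\{-a,0\}$, the first two upper limits are over $y\ne x$ (and are $0$ at isolated points), and the last one is the upper semicontinuous envelope. Let $\underline{\mathcal C}(\Omega)$ (resp. $\overline{\mathcal C}(\Omega)$) be the set of locally Lipschitz $\psi$ on $\Omega$ such that $|\nabla\psi|$ is continuous and $|\nabla^-\psi|=|\nabla\psi|$ (resp. $|\nabla^+\psi|=|\nabla\psi|$) in $\Omega$. For $a,p\ge0$ put $$H_a(x,\rho,p)=\inf_{q\ge0,\,|q-p|\le a}H(x,\rho,q),\qquad H^a(x,\rho,p)=\sup_{q\ge0,\,|q-p|\le a}H(x,\rho,q).$$ A function $u:\Omega\to\mathbb R$ is a *Monge solution* of $H(x,u,|\nabla u|)=0$ in $\Omega$ if $u$ is locally Lipschitz and $H(x,u(x),|\nabla^-u|(x))=0$ for every $x\in\Omega$. It is an *s-solution* if $u$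 is continuous and, for every $\psi_1\in\underline{\mathcal C}(\Omega)$ (resp. $\psi_1\in\overline{\mathcal C}(\Omega)$) and every locally Lipschitz $\psi_2$ on $\Omega$ such that $u-\psi_1-\psi_2$ has a local maximum (resp. local minimum) at a point $x\in\Omega$, $$H_{|\nabla\psi_2|^*(x)}\big(x,u(x),|\nabla\psi_1|(x)\big)\le0\qquad\Big(\text{resp. } H^{|\nabla\psi_2|^*(x)}\big(x,u(x),|\nabla\psi_1|(x)\big)\ge0\Big).$$ A function is *locally uniformly continuous* in $\Omega$ if every point of $\Omega$ is the centre of a ball contained in $\Omega$ on which it is uniformly continuous. Then a function $u:\Omega\to\mathbb R$ is a Monge solution of $H(x,u,|\nabla u|)=0$ in $\Omega$ if and only if it is a locally uniformly continuous s-solution of this equation in $\Omega$. In addition, any such $u$ is locally Lipschitz in $\Omega$. -/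

import Mathlib

open Set Filter Topology

namespace MetricHJ

variable {X : Type*} [MetricSpace X]

/-- A length space: the distance between two points is the infimum of the lengths of the
continuous curves joining them. Since `edist x y < ∞`, any two points are joined by a curve of
finite length. -/
def IsLengthSpace (X : Type*) [MetricSpace X] : Prop :=
  ∀ x y : X, edist x y = ⨅ γ : Path x y, eVariationOn γ univ

/-- Local uniform continuity on an open set: uniform continuity in a small ball around each
point. -/
def LocallyUniformContinuousOn (u : X → ℝ) (Ω : Set X) : Prop :=
  ∀ x ∈ Ω, ∃ r > 0, Metric.ball x r ⊆ Ω ∧ UniformContinuousOn u (Metric.ball x r)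

/-- A modulus of continuity: vanishing at `0`, nondecreasing on `[0, ∞)`, continuous at `0`. -/
def IsModulus (ω : ℝ → ℝ) : Prop :=
  ω 0 = 0 ∧ MonotoneOn ω (Ici 0) ∧ ContinuousWithinAt ω (Ici 0) 0

/- The slopes are only used for functions that are locally Lipschitz near `x`: the quotients are
then bounded near `x`, and the real `limsup` is the usual one. At an isolated point it is `0`. -/

/-- The local slope `|∇u|(x)`. -/
noncomputable def localSlope (u : X → ℝ) (x : X) : ℝ :=
  limsup (fun y => |u y - u x| / dist x y) (𝓝[≠] x)

/-- The super-slope `|∇⁺u|(x)`. -/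
noncomputable def superSlope (u : X → ℝ) (x : X) : ℝ :=
  limsup (fun y => max (u y - u x) 0 / dist x y) (𝓝[≠] x)

/-- The sub-slope `|∇⁻u|(x)`, with `[a]₋ = max (-a) 0`. -/
noncomputable def subSlope (u : X → ℝ) (x : X) : ℝ :=
  limsup (fun y => max (u x - u y) 0 / dist x y) (𝓝[≠] x)

/-- The upper semicontinuous envelope `|∇u|^*(x)` of the local slope. -/
noncomputable def localSlopeEnvelope (u : X → ℝ) (x : X) : ℝ :=
  limsup (fun y => localSlope u y) (𝓝 x)

/-- The test class `𝒞̲(Ω)` (sub-slope equals slope, slope continuous). -/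
def LowerTestClass (Ω : Set X) : Set (X → ℝ) :=
  {ψ | LocallyLipschitzOn Ω ψ ∧ (∀ x ∈ Ω, subSlope ψ x = localSlope ψ x) ∧
    ContinuousOn (localSlope ψ) Ω}

/-- The test class `𝒞̅(Ω)` (super-slope equals slope, slope continuous). -/
def UpperTestClass (Ω : Set X) : Set (X → ℝ) :=
  {ψ | LocallyLipschitzOn Ω ψ ∧ (∀ x ∈ Ω, superSlope ψ x = localSlope ψ x) ∧
    ContinuousOn (localSlope ψ) Ω}

/-- `H_a(x, ρ, p)`, the infimum of `H(x, ρ, q)` over `|q - p| ≤ a`, where `q` ranges over the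
domain `[0, ∞)` of `H(x, ρ, ·)`. -/
noncomputable def lowerRelax (H : X → ℝ → ℝ → ℝ) (a : ℝ) (x : X) (ρ p : ℝ) : ℝ :=
  sInf (H x ρ '' {q | 0 ≤ q ∧ |q - p| ≤ a})

/-- `H^a(x, ρ, p)`, the supremum of `H(x, ρ, q)` over `|q - p| ≤ a`, where `q` ranges over the
domain `[0, ∞)` of `H(x, ρ, ·)`. -/
noncomputable def upperRelax (H : X → ℝ → ℝ → ℝ) (a : ℝ) (x : X) (ρ p : ℝ) : ℝ :=
  sSup (H x ρ '' {q | 0 ≤ q ∧ |q - p| ≤ a})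

/-- Slope-based viscosity subsolution of `H(x, u, |∇u|) = 0` in `Ω`. -/
def IsSSubsolution (Ω : Set X) (H : X → ℝ → ℝ → ℝ) (u : X → ℝ) : Prop :=
  UpperSemicontinuousOn u Ω ∧
    ∀ ψ₁ ∈ LowerTestClass Ω, ∀ ψ₂ : X → ℝ, LocallyLipschitzOn Ω ψ₂ →
      ∀ x ∈ Ω, IsLocalMax (fun y => u y - ψ₁ y - ψ₂ y) x →
        lowerRelax H (localSlopeEnvelope ψ₂ x) x (u x) (localSlope ψ₁ x) ≤ 0

/-- Slope-based viscosity supersolution of `H(x, u, |∇u|) = 0` in `Ω`. -/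
def IsSSupersolution (Ω : Set X) (H : X → ℝ → ℝ → ℝ) (u : X → ℝ) : Prop :=
  LowerSemicontinuousOn u Ω ∧
    ∀ ψ₁ ∈ UpperTestClass Ω, ∀ ψ₂ : X → ℝ, LocallyLipschitzOn Ω ψ₂ →
      ∀ x ∈ Ω, IsLocalMin (fun y => u y - ψ₁ y - ψ₂ y) x →
        0 ≤ upperRelax H (localSlopeEnvelope ψ₂ x) x (u x) (localSlope ψ₁ x)

/-- s-solution: a continuous function that is both an s-subsolution and an s-supersolution. -/
def IsSSolution (Ω : Set X) (H : X → ℝ → ℝ → ℝ) (u : X → ℝ) : Prop :=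
  ContinuousOn u Ω ∧ IsSSubsolution Ω H u ∧ IsSSupersolution Ω H u

/-- Monge subsolution of `H(x, u, |∇u|) = 0` in `Ω`. -/
def IsMongeSubsolution (Ω : Set X) (H : X → ℝ → ℝ → ℝ) (u : X → ℝ) : Prop :=
  LocallyLipschitzOn Ω u ∧ ∀ x ∈ Ω, H x (u x) (subSlope u x) ≤ 0

/-- Monge supersolution of `H(x, u, |∇u|) = 0` in `Ω`. -/
def IsMongeSupersolution (Ω : Set X) (H : X → ℝ → ℝ → ℝ) (u : X → ℝ) : Prop :=
  LocallyLipschitzOn Ω u ∧ ∀ x ∈ Ω, 0 ≤ H x (u x) (subSlope u x)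

/-- Monge solution of `H(x, u, |∇u|) = 0` in `Ω`. -/
def IsMongeSolution (Ω : Set X) (H : X → ℝ → ℝ → ℝ) (u : X → ℝ) : Prop :=
  IsMongeSubsolution Ω H u ∧ IsMongeSupersolution Ω H u

end MetricHJ

namespace MetricHJ

/-! Since `H` increases in the slope variable, `H_a` and `H^a` are the values of `H` at slopes `max
(p - a) 0` and `p + a`. A Monge solution is then an s-solution by subadditivity of upper limits:
contact from above gives `|∇⁻ψ₁| ≤ |∇⁻u| + |∇ψ₂|`, contact from below gives `|∇⁻u| ≤ |∇ψ₁| + |∇ψ₂|`.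

For the converse, balls need not be compact, so contact points come from Ekeland's principle; its
penalty `η d(·, x)` plays the role of `ψ₂` and shifts slopes by at most `η`. The main test functions
are `±g(d(·, z))` with `g' ≥ 0` and `g' 0 = 0`, which lie in the test classes because `X` is a
length space.

If `H(x, u, P) > 0` near a point, comparing a subsolution with a smoothed cone gives `u y - u z ≤ K
d(y, z) + A d(y, z)²` for any `K > P` (`le_cone_of_subsolution`). With `P` from coercivity, `u` is
locally Lipschitz; with `P` just below `|∇⁻u|(x₀)`, the Monge subsolution inequality follows. If
instead `H < 0` at `|∇⁻u|(x₀)`, a downward smoothed cone slightly steeper than `|∇⁻u|(x₀)` touches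
`u` from below and contradicts the supersolution property. -/

/-- Ekeland's variational principle for a continuous function on a closed set. -/
theorem exists_ekeland_min {X : Type*} [MetricSpace X] [CompleteSpace X] {C : Set X}
    (hC : IsClosed C) {F : X → ℝ} (hF : ContinuousOn F C) {m : ℝ} (hm : ∀ x ∈ C, m ≤ F x)
    {x₀ : X} (hx₀ : x₀ ∈ C) {η : ℝ} (hη : 0 < η) :
    ∃ x ∈ C, F x ≤ F x₀ ∧ ∀ w ∈ C, F x ≤ F w + η * dist w x := by
  -- Call `w` below `x` if `F w + η d(w, x) ≤ F x`. Each step moves to a `2⁻ⁿ`-minimiser of `F`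
  -- among the points below the current one.
  have step : ∀ (n : ℕ) (x : C), ∃ y : C, F y + η * dist (y : X) x ≤ F x ∧
      ∀ w ∈ C, F w + η * dist w (x : X) ≤ F x → F (y : X) ≤ F w + (1 / 2) ^ n := by
    intro n x
    set S : Set X := {w | w ∈ C ∧ F w + η * dist w (x : X) ≤ F x} with hS
    have hxS : (x : X) ∈ S := ⟨x.2, by simp⟩
    have hbdd : BddBelow (F '' S) := ⟨m, by rintro _ ⟨w, hw, rfl⟩; exact hm w hw.1⟩
    obtain ⟨_, ⟨y, hy, rfl⟩, hlt⟩ := Real.lt_sInf_add_pos (s := F '' S) ⟨_, _, hxS, rfl⟩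
      (show (0 : ℝ) < (1 / 2) ^ n by positivity)
    refine ⟨⟨y, hy.1⟩, hy.2, fun w hw hwx => ?_⟩
    have := csInf_le hbdd ⟨w, ⟨hw, hwx⟩, rfl⟩
    simp only
    linarith
  choose g hg₁ hg₂ using step
  obtain ⟨s, hs0, hs⟩ : ∃ s : ℕ → C, s 0 = ⟨x₀, hx₀⟩ ∧ ∀ n, s (n + 1) = g n (s n) :=
    ⟨fun n => Nat.rec ⟨x₀, hx₀⟩ (fun k x => g k x) n, rfl, fun _ => rfl⟩
  have mem : ∀ n k : ℕ, F (s (n + k) : X) + η * dist (s (n + k) : X) (s n) ≤ F (s n : X) := by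
    intro n k
    induction k with
    | zero => simp
    | succ k ih =>
      have h1 := hg₁ (n + k) (s (n + k))
      rw [← hs] at h1
      have h2 := mul_le_mul_of_nonneg_left
        (dist_triangle (s (n + k + 1) : X) (s (n + k)) (s n)) hη.le
      rw [← add_assoc]
      linarith
  have mem' : ∀ n k : ℕ, n ≤ k → F (s k) + η * dist (s k : X) (s n) ≤ F (s n : X) := by
    intro n k h
    obtain ⟨j, rfl⟩ := Nat.exists_eq_add_of_le h
    exact mem n j
  have small : ∀ n k, n + 1 ≤ k → η * dist (s k : X) (s (n + 1)) ≤ (1 / 2) ^ n := by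
    intro n k h
    have h1 := mem' (n + 1) k h
    have h2 := hg₂ n (s n) (s k : X) (s k).2 (mem' n k (by lia))
    rw [← hs] at h2
    linarith
  have hcau : CauchySeq fun n => (s (n + 1) : X) := by
    refine cauchySeq_of_le_tendsto_0' (fun n => (1 / 2 : ℝ) ^ n / η) (fun n k h => ?_) ?_
    · rw [le_div_iff₀ hη, dist_comm, mul_comm]
      exact small n (k + 1) (by lia)
    · simpa using (tendsto_pow_atTop_nhds_zero_of_lt_one (by norm_num : (0 : ℝ) ≤ 1 / 2)
        (by norm_num)).div_const η
  obtain ⟨x, hx⟩ := cauchySeq_tendsto_of_complete hcau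
  have hxC : x ∈ C := hC.mem_of_tendsto hx (Eventually.of_forall fun n => (s (n + 1)).2)
  have hFx : Tendsto (fun n => F (s (n + 1))) atTop (𝓝 (F x)) :=
    (hF x hxC).tendsto.comp (tendsto_nhdsWithin_iff.2
      ⟨hx, Eventually.of_forall fun n => (s (n + 1)).2⟩)
  have lim : ∀ n : ℕ, F x + η * dist x (s n : X) ≤ F (s n : X) := by
    intro n
    refine le_of_tendsto (hFx.add ((hx.dist tendsto_const_nhds).const_mul η)) ?_
    filter_upwards [eventually_ge_atTop n] with k hk
    exact mem' n (k + 1) (by lia)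
  refine ⟨x, hxC, ?_, fun w hw => ?_⟩
  · have := lim 0
    have h0 : 0 ≤ η * dist x (s 0 : X) := by positivity
    have h1 : F (s 0 : X) = F x₀ := by rw [hs0]
    linarith
  -- A violating `w` is below every `s n`, so near-minimality forces `F x ≤ F w`.
  · by_contra! hlt
    have key : ∀ n : ℕ, F x ≤ F w + (1 / 2) ^ n := by
      intro n
      have h1 := mul_le_mul_of_nonneg_left (dist_triangle w x (s n : X)) hη.le
      have h2 := hg₂ n (s n) w hw (by linarith [lim n])
      rw [← hs] at h2
      have h3 := lim (n + 1)
      have h0 : 0 ≤ η * dist x (s (n + 1) : X) := by positivity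
      linarith
    have h4 : F x ≤ F w + 0 := le_of_tendsto_of_tendsto' tendsto_const_nhds
      (tendsto_const_nhds.add (tendsto_pow_atTop_nhds_zero_of_lt_one
        (by norm_num : (0 : ℝ) ≤ 1 / 2) (by norm_num))) key
    have h0 : 0 ≤ η * dist w x := by positivity
    linarith

/-! ### Real upper limits of nonnegative functions. -/

section Limsup

variable {α : Type*} {l : Filter α} {f g h : α → ℝ}

theorem real_limsup_nonneg (hf : ∀ y, 0 ≤ f y) : 0 ≤ limsup f l := by
  rw [limsup_eq]
  rcases l.eq_or_neBot with rfl | hl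
  -- Along the trivial filter (isolated points) the upper limit is `sInf univ = 0`.
  · simp
  · refine Real.sInf_nonneg fun a ha => ?_
    obtain ⟨y, hy⟩ := ha.exists
    exact (hf y).trans hy

theorem real_limsup_le {c : ℝ} (hf : ∀ y, 0 ≤ f y) (hc : 0 ≤ c) (h : ∀ᶠ y in l, f y ≤ c) :
    limsup f l ≤ c := by
  rcases l.eq_or_neBot with rfl | hl
  · simpa [limsup_eq] using hc
  · exact limsup_le_of_le ⟨0, fun a ha =>
      (eventually_map.1 ha).exists.elim fun y hy => (hf y).trans hy⟩ h

/-- Subadditivity of the upper limit of nonnegative functions. -/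
theorem real_limsup_le_add (hf : ∀ y, 0 ≤ f y) (hg : ∀ y, 0 ≤ g y) (hh : ∀ y, 0 ≤ h y)
    (hgb : l.IsBoundedUnder (· ≤ ·) g) (hhb : l.IsBoundedUnder (· ≤ ·) h)
    (hle : ∀ᶠ y in l, f y ≤ g y + h y) : limsup f l ≤ limsup g l + limsup h l := by
  refine le_of_forall_pos_le_add fun ε hε => ?_
  have h1 := eventually_lt_of_limsup_lt
    (show limsup g l < limsup g l + ε / 2 by linarith) hgb
  have h2 := eventually_lt_of_limsup_lt
    (show limsup h l < limsup h l + ε / 2 by linarith) hhb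
  refine real_limsup_le hf ?_ ?_
  · linarith [real_limsup_nonneg (l := l) hg, real_limsup_nonneg (l := l) hh]
  · filter_upwards [hle, h1, h2] with y h3 h4 h5
    linarith

end Limsup

/-- By monotonicity the infimum is attained at the left end of the slope interval, cut off at `0`.
-/
theorem lowerRelax_nonpos_iff {X : Type*} {H : X → ℝ → ℝ → ℝ} {x : X} {ρ a p : ℝ}
    (hH : MonotoneOn (H x ρ) (Ici 0)) (ha : 0 ≤ a) (hp : 0 ≤ p) :
    lowerRelax H a x ρ p ≤ 0 ↔ H x ρ (max (p - a) 0) ≤ 0 := by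
  have : lowerRelax H a x ρ p = H x ρ (max (p - a) 0) := by
    refine IsLeast.csInf_eq ⟨⟨_, ⟨le_max_right _ _, ?_⟩, rfl⟩, ?_⟩
    · rw [abs_le]
      constructor
      · linarith [le_max_left (p - a) 0]
      · linarith [max_le (by linarith : p - a ≤ p + a) (by linarith : 0 ≤ p + a)]
    · rintro _ ⟨q, ⟨hq, hqp⟩, rfl⟩
      exact hH (mem_Ici.2 (le_max_right _ _)) hq (max_le (by linarith [(abs_le.1 hqp).1]) hq)
  rw [this]

theorem upperRelax_nonneg_iff {X : Type*} {H : X → ℝ → ℝ → ℝ} {x : X} {ρ a p : ℝ}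
    (hH : MonotoneOn (H x ρ) (Ici 0)) (ha : 0 ≤ a) (hp : 0 ≤ p) :
    0 ≤ upperRelax H a x ρ p ↔ 0 ≤ H x ρ (p + a) := by
  have : upperRelax H a x ρ p = H x ρ (p + a) := by
    refine IsGreatest.csSup_eq ⟨⟨_, ⟨by positivity, by simp [abs_of_nonneg ha]⟩, rfl⟩, ?_⟩
    rintro _ ⟨q, ⟨hq, hqp⟩, rfl⟩
    exact hH hq (by simp only [mem_Ici]; positivity) (by linarith [(abs_le.1 hqp).2])
  rw [this]

/-! ### Slopes of locally Lipschitz functions. -/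

section LipschitzFunctions

variable {X : Type*} [MetricSpace X]

theorem exists_lipschitz_ball {Ω : Set X} (hΩ : IsOpen Ω) {f : X → ℝ}
    (hf : LocallyLipschitzOn Ω f) {x : X} (hx : x ∈ Ω) :
    ∃ K ≥ 0, ∃ r > 0, Metric.ball x r ⊆ Ω ∧
      ∀ y ∈ Metric.ball x r, ∀ z ∈ Metric.ball x r, |f y - f z| ≤ K * dist y z := by
  obtain ⟨K, t, ht, hK⟩ := hf hx
  rw [hΩ.nhdsWithin_eq hx] at ht
  obtain ⟨r, hr, hrt⟩ := Metric.mem_nhds_iff.1 (inter_mem ht (hΩ.mem_nhds hx))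
  refine ⟨K, K.2, r, hr, fun y hy => (hrt hy).2, fun y hy z hz => ?_⟩
  have := hK.dist_le_mul y (hrt hy).1 z (hrt hz).1
  rwa [Real.dist_eq] at this

theorem locallyLipschitzOn_of_ball {Ω : Set X} {f : X → ℝ}
    (h : ∀ x ∈ Ω, ∃ K ≥ 0, ∃ r > 0,
      ∀ y ∈ Metric.ball x r, ∀ z ∈ Metric.ball x r, |f y - f z| ≤ K * dist y z) :
    LocallyLipschitzOn Ω f := by
  intro x hx
  obtain ⟨K, hK0, r, hr, hK⟩ := h x hx
  refine ⟨⟨K, hK0⟩, Metric.ball x r, mem_nhdsWithin_of_mem_nhds (Metric.ball_mem_nhds x hr),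
    LipschitzOnWith.of_dist_le_mul fun y hy z hz => ?_⟩
  rw [Real.dist_eq]
  exact hK y hy z hz

theorem localSlope_nonneg (u : X → ℝ) (x : X) : 0 ≤ localSlope u x :=
  real_limsup_nonneg fun _ => by positivity

theorem subSlope_nonneg (u : X → ℝ) (x : X) : 0 ≤ subSlope u x :=
  real_limsup_nonneg fun _ => by positivity

theorem localSlopeEnvelope_nonneg (u : X → ℝ) (x : X) : 0 ≤ localSlopeEnvelope u x :=
  real_limsup_nonneg fun _ => localSlope_nonneg u _

theorem localSlope_neg (u : X → ℝ) : localSlope (fun y => -u y) = localSlope u := by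
  ext x
  unfold localSlope
  congr 1
  ext y
  rw [← abs_neg]
  congr 2
  ring

theorem superSlope_neg (u : X → ℝ) (x : X) : superSlope (fun y => -u y) x = subSlope u x := by
  unfold superSlope subSlope
  congr 1
  ext y
  congr 2
  ring

theorem neg_mem_upperTestClass {Ω : Set X} {ψ : X → ℝ} (h : ψ ∈ LowerTestClass Ω) :
    (fun y => -ψ y) ∈ UpperTestClass Ω := by
  refine ⟨h.1.neg, fun x hx => ?_, ?_⟩
  · rw [superSlope_neg, localSlope_neg]
    exact h.2.1 x hx
  · rw [localSlope_neg]
    exact h.2.2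

theorem localSlope_le {u : X → ℝ} {x : X} {c : ℝ} (hc : 0 ≤ c)
    (h : ∀ᶠ y in 𝓝 x, |u y - u x| ≤ c * dist x y) : localSlope u x ≤ c := by
  refine real_limsup_le (fun _ => by positivity) hc ?_
  filter_upwards [nhdsWithin_le_nhds h] with y hy
  exact div_le_of_le_mul₀ dist_nonneg hc hy

theorem subSlope_le {u : X → ℝ} {x : X} {c : ℝ} (hc : 0 ≤ c)
    (h : ∀ᶠ y in 𝓝 x, u x - u y ≤ c * dist x y) : subSlope u x ≤ c := by
  refine real_limsup_le (fun _ => by positivity) hc ?_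
  filter_upwards [nhdsWithin_le_nhds h] with y hy
  exact div_le_of_le_mul₀ dist_nonneg hc (max_le hy (by positivity))

section Lip

variable {Ω : Set X} {u ψ₁ ψ₂ : X → ℝ} {x : X}

theorem isBoundedUnder_localSlope (hΩ : IsOpen Ω) (hu : LocallyLipschitzOn Ω u) (hx : x ∈ Ω) :
    (𝓝[≠] x).IsBoundedUnder (· ≤ ·) fun y => |u y - u x| / dist x y := by
  obtain ⟨K, hK0, r, hr, -, hK⟩ := exists_lipschitz_ball hΩ hu hx
  refine ⟨K, eventually_map.2 ?_⟩
  filter_upwards [nhdsWithin_le_nhds (Metric.ball_mem_nhds x hr)] with y hy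
  rw [dist_comm]
  exact div_le_of_le_mul₀ dist_nonneg hK0 (hK y hy x (Metric.mem_ball_self hr))

theorem isBoundedUnder_subSlope (hΩ : IsOpen Ω) (hu : LocallyLipschitzOn Ω u) (hx : x ∈ Ω) :
    (𝓝[≠] x).IsBoundedUnder (· ≤ ·) fun y => max (u x - u y) 0 / dist x y := by
  refine (isBoundedUnder_localSlope hΩ hu hx).mono_le (Eventually.of_forall fun y => ?_)
  have : max (u x - u y) 0 ≤ |u y - u x| :=
    max_le (by rw [abs_sub_comm]; exact le_abs_self _) (abs_nonneg _)
  simp only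
  gcongr

theorem eventually_of_subSlope_lt (hΩ : IsOpen Ω) (hu : LocallyLipschitzOn Ω u) (hx : x ∈ Ω)
    {c : ℝ} (h : subSlope u x < c) : ∀ᶠ y in 𝓝 x, u x - u y ≤ c * dist x y := by
  have h1 := eventually_lt_of_limsup_lt h (isBoundedUnder_subSlope hΩ hu hx)
  rw [eventually_nhdsWithin_iff] at h1
  filter_upwards [h1] with y hy
  by_cases hyx : y = x
  · simp [hyx]
  · have h2 := (div_lt_iff₀ (dist_pos.2 (Ne.symm hyx))).1 (hy hyx)
    exact (le_max_left _ _).trans h2.le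

theorem localSlope_le_envelope (hΩ : IsOpen Ω) (hu : LocallyLipschitzOn Ω u) (hx : x ∈ Ω) :
    localSlope u x ≤ localSlopeEnvelope u x := by
  obtain ⟨K, hK0, r, hr, -, hK⟩ := exists_lipschitz_ball hΩ hu hx
  refine le_limsup_of_frequently_le ?_ ⟨K, eventually_map.2 ?_⟩
  -- The envelope is an upper limit over the unpunctured filter, so `x` itself counts.
  · exact Filter.Frequently.filter_mono (f := pure x) (by simp) (pure_le_nhds x)
  · filter_upwards [Metric.ball_mem_nhds x hr] with y hy
    refine localSlope_le hK0 ?_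
    filter_upwards [Metric.isOpen_ball.mem_nhds hy] with z hz
    rw [dist_comm]
    exact hK z hz y hy

/-- The maximum gives `ψ₁ x - ψ₁ y ≤ (u x - u y) + (ψ₂ y - ψ₂ x)` near `x`. -/
theorem subSlope_le_of_touching_above (hΩ : IsOpen Ω) (hu : LocallyLipschitzOn Ω u)
    (h₂ : LocallyLipschitzOn Ω ψ₂) (hx : x ∈ Ω)
    (hmax : IsLocalMax (fun y => u y - ψ₁ y - ψ₂ y) x) :
    subSlope ψ₁ x ≤ subSlope u x + localSlope ψ₂ x := by
  refine real_limsup_le_add (fun _ => by positivity) (fun _ => by positivity)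
    (fun _ => by positivity) (isBoundedUnder_subSlope hΩ hu hx)
    (isBoundedUnder_localSlope hΩ h₂ hx) ?_
  filter_upwards [nhdsWithin_le_nhds hmax] with y hy
  rw [← add_div]
  gcongr
  have := neg_abs_le (ψ₂ y - ψ₂ x)
  refine max_le ?_ (by positivity)
  have := le_max_left (u x - u y) 0
  linarith [le_abs_self (ψ₂ y - ψ₂ x)]

theorem subSlope_le_of_touching_below (hΩ : IsOpen Ω)
    (h₁ : LocallyLipschitzOn Ω ψ₁) (h₂ : LocallyLipschitzOn Ω ψ₂) (hx : x ∈ Ω)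
    (hmin : IsLocalMin (fun y => u y - ψ₁ y - ψ₂ y) x) :
    subSlope u x ≤ localSlope ψ₁ x + localSlope ψ₂ x := by
  refine real_limsup_le_add (fun _ => by positivity) (fun _ => by positivity)
    (fun _ => by positivity) (isBoundedUnder_localSlope hΩ h₁ hx)
    (isBoundedUnder_localSlope hΩ h₂ hx) ?_
  filter_upwards [nhdsWithin_le_nhds hmin] with y hy
  rw [← add_div]
  gcongr
  refine max_le ?_ (by positivity)
  linarith [neg_abs_le (ψ₂ y - ψ₂ x), neg_abs_le (ψ₁ y - ψ₁ x)]

theorem locallyUniformContinuousOn (hΩ : IsOpen Ω) (hu : LocallyLipschitzOn Ω u) :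
    LocallyUniformContinuousOn u Ω := by
  intro x hx
  obtain ⟨K, hK0, r, hr, hrΩ, hK⟩ := exists_lipschitz_ball hΩ hu hx
  refine ⟨r, hr, hrΩ, LipschitzOnWith.uniformContinuousOn (K := ⟨K, hK0⟩)
    (LipschitzOnWith.of_dist_le_mul fun y hy z hz => ?_)⟩
  rw [Real.dist_eq]
  exact hK y hy z hz

end Lip

end LipschitzFunctions

/-! ### Length spaces and radial test functions. -/

section Length

variable {X : Type*} [MetricSpace X]

/-- In a length space there are almost geodesic intermediate points at each distance. -/
theorem IsLengthSpace.exists_between (hX : IsLengthSpace X) {x z : X} {s ε : ℝ} (hs : 0 ≤ s)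
    (hsd : s ≤ dist x z) (hε : 0 < ε) :
    ∃ y, dist x y = s ∧ s + dist y z ≤ dist x z + ε := by
  have hlt : edist x z < ENNReal.ofReal (dist x z + ε) := by
    rw [edist_dist, ENNReal.ofReal_lt_ofReal_iff (by positivity)]
    linarith
  rw [hX x z, iInf_lt_iff] at hlt
  obtain ⟨γ, hγ⟩ := hlt
  have hc : Continuous fun t => dist x (γ t) := by fun_prop
  obtain ⟨t, ht⟩ : ∃ t, dist x (γ t) = s := by
    refine mem_range_of_exists_le_of_exists_ge hc ⟨0, by simpa using hs⟩ ⟨1, by simpa using hsd⟩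
  refine ⟨γ t, ht, ?_⟩
  have h1 : edist x (γ t) ≤ eVariationOn γ (Iic t) := by
    simpa using eVariationOn.edist_le γ (s := Iic t) (x := 0) (y := t) t.2.1 (mem_Iic.2 le_rfl)
  have h2 : edist (γ t) z ≤ eVariationOn γ (Ici t) := by
    simpa using eVariationOn.edist_le γ (s := Ici t) (x := t) (y := 1) (mem_Ici.2 le_rfl) t.2.2
  have h3 : eVariationOn γ (Iic t) + eVariationOn γ (Ici t) ≤ eVariationOn γ univ :=
    (eVariationOn.add_le_union γ fun a ha b hb => le_trans ha hb).trans
      (eVariationOn.mono γ (subset_univ _))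
  have h4 := ((add_le_add h1 h2).trans h3).trans hγ.le
  rw [edist_dist, edist_dist, ← ENNReal.ofReal_add dist_nonneg dist_nonneg,
    ENNReal.ofReal_le_ofReal_iff (by positivity), ht] at h4
  exact h4

/-- The profile of a radial test function: continuously differentiable, nondecreasing, with
vanishing derivative at the origin. -/
structure IsRadialProfile (g g' : ℝ → ℝ) : Prop where
  hasDerivAt : ∀ t, 0 ≤ t → HasDerivAt g (g' t) t
  continuousOn : ContinuousOn g' (Ici 0)
  nonneg : ∀ t, 0 ≤ t → 0 ≤ g' t
  zero : g' 0 = 0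

variable {g g' : ℝ → ℝ}

theorem IsRadialProfile.mono (hg : IsRadialProfile g g') : MonotoneOn g (Ici 0) := by
  refine monotoneOn_of_hasDerivWithinAt_nonneg (f' := g') (convex_Ici 0)
    (fun t ht => (hg.hasDerivAt t ht).continuousAt.continuousWithinAt) (fun t ht => ?_)
    fun t ht => ?_
  · exact (hg.hasDerivAt t (interior_subset ht)).hasDerivWithinAt
  · exact hg.nonneg t (interior_subset ht)

theorem IsRadialProfile.le_apply_dist (hg : IsRadialProfile g g') (x z : X) :
    g 0 ≤ g (dist x z) :=
  hg.mono self_mem_Ici (mem_Ici.2 dist_nonneg) dist_nonneg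

theorem IsRadialProfile.eventually (hg : IsRadialProfile g g') (z x : X) {ε : ℝ} (hε : 0 < ε) :
    ∀ᶠ y in 𝓝 x, |g (dist y z) - g (dist x z) - g' (dist x z) * (dist y z - dist x z)| ≤
      ε * |dist y z - dist x z| := by
  have h := (hg.hasDerivAt (dist x z) dist_nonneg).isLittleO.def hε
  have hc : Tendsto (fun y => dist y z) (𝓝 x) (𝓝 (dist x z)) :=
    Continuous.tendsto (by fun_prop) x
  filter_upwards [hc.eventually h] with y hy
  simpa [mul_comm] using hy

theorem IsRadialProfile.localSlope_le (hg : IsRadialProfile g g') (z x : X) :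
    localSlope (fun y => g (dist y z)) x ≤ g' (dist x z) := by
  refine le_of_forall_pos_le_add fun ε hε => ?_
  have h0 := hg.nonneg (dist x z) dist_nonneg
  refine MetricHJ.localSlope_le (by positivity) ?_
  filter_upwards [hg.eventually z x hε] with y hy
  have h1 : |dist y z - dist x z| ≤ dist x y := by
    rw [dist_comm x y]; exact abs_dist_sub_le y x z
  calc |g (dist y z) - g (dist x z)|
      = |(g (dist y z) - g (dist x z) - g' (dist x z) * (dist y z - dist x z)) +
          g' (dist x z) * (dist y z - dist x z)| := by ring_nf
    _ ≤ ε * |dist y z - dist x z| + g' (dist x z) * |dist y z - dist x z| := by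
        refine (abs_add_le _ _).trans (add_le_add hy ?_)
        rw [abs_mul, abs_of_nonneg h0]
    _ = (g' (dist x z) + ε) * |dist y z - dist x z| := by ring
    _ ≤ (g' (dist x z) + ε) * dist x y := by gcongr

theorem IsRadialProfile.locallyLipschitzOn (hg : IsRadialProfile g g') (z : X) (Ω : Set X) :
    LocallyLipschitzOn Ω fun y => g (dist y z) := by
  refine locallyLipschitzOn_of_ball fun x _ => ?_
  obtain ⟨C, hC⟩ := isCompact_Icc.exists_bound_of_continuousOn
    (hg.continuousOn.mono (Icc_subset_Ici_self : Icc 0 (dist x z + 1) ⊆ Ici 0))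
  have hC0 : 0 ≤ C := (norm_nonneg _).trans (hC 0 ⟨le_rfl, by positivity⟩)
  have mem : ∀ y ∈ Metric.ball x 1, dist y z ∈ Icc 0 (dist x z + 1) := fun y hy =>
    ⟨dist_nonneg, by linarith [dist_triangle y x z, Metric.mem_ball.1 hy]⟩
  refine ⟨C, hC0, 1, one_pos, fun y hy w hw => ?_⟩
  have := (convex_Icc 0 (dist x z + 1)).norm_image_sub_le_of_norm_hasDerivWithin_le
    (fun t ht => (hg.hasDerivAt t ht.1).hasDerivWithinAt) hC (mem w hw) (mem y hy)
  rw [Real.norm_eq_abs, Real.norm_eq_abs] at this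
  exact this.trans (by gcongr; exact abs_dist_sub_le y w z)

theorem subSlope_le_localSlope {Ω : Set X} (hΩ : IsOpen Ω) {u : X → ℝ}
    (hu : LocallyLipschitzOn Ω u) {x : X} (hx : x ∈ Ω) : subSlope u x ≤ localSlope u x := by
  -- Here `0 - u - (-u)` vanishes identically, so every point is a local maximum.
  have := subSlope_le_of_touching_above (ψ₁ := u) (u := fun _ => 0) (ψ₂ := fun y => -u y) hΩ
    (LocallyLipschitz.const _).locallyLipschitzOn hu.neg hx (by simp [IsLocalMax, IsMaxFilter])
  rw [localSlope_neg] at this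
  have h0 : subSlope (fun _ : X => (0 : ℝ)) x ≤ 0 := subSlope_le le_rfl (by simp)
  linarith

/-- Moving from `x` towards `z` along an almost shortest curve decreases `d(·, z)` at nearly unit
rate. The vertex `x = z` is harmless since `g' 0 = 0`. -/
theorem IsRadialProfile.le_subSlope (hX : IsLengthSpace X) (hg : IsRadialProfile g g') (z x : X) :
    g' (dist x z) ≤ subSlope (fun y => g (dist y z)) x := by
  rcases (hg.nonneg (dist x z) dist_nonneg).eq_or_lt with h0 | h0
  · rw [← h0]; exact subSlope_nonneg _ _
  have hd : 0 < dist x z := by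
    rcases (dist_nonneg (x := x) (y := z)).eq_or_lt with h | h
    · rw [← h, hg.zero] at h0; exact absurd h0 (lt_irrefl _)
    · exact h
  by_contra! hlt
  obtain ⟨c, hc1, hc2⟩ := exists_between hlt
  have hc0 : 0 ≤ c := (subSlope_nonneg _ _).trans hc1.le
  have hev := eventually_of_subSlope_lt isOpen_univ (hg.locallyLipschitzOn z univ) (mem_univ x) hc1
  set p := g' (dist x z)
  -- One third of the gap pays for linearising `g`, one for the curve not being a geodesic, and one
  -- gives the contradiction.
  set ε := (p - c) / 3 with hε
  have hε0 : 0 < ε := by rw [hε]; linarith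
  obtain ⟨r, hr, hball⟩ := Metric.eventually_nhds_iff.1 (hev.and (hg.eventually z x hε0))
  set s := min (r / 2) (dist x z)
  have hs0 : 0 < s := lt_min (by linarith) hd
  have hκ : 0 < ε / p := by positivity
  obtain ⟨y, hy1, hy2⟩ := hX.exists_between hs0.le (min_le_right _ _ : s ≤ dist x z)
    (show 0 < s * (ε / p) by positivity)
  obtain ⟨h1, h2⟩ := hball (y := y) (by
    rw [dist_comm, hy1]; linarith [min_le_left (r / 2) (dist x z)])
  rw [hy1] at h1
  have h3 : |dist y z - dist x z| ≤ s := by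
    rw [← hy1, dist_comm x y]; exact abs_dist_sub_le y x z
  have h4 := (abs_le.1 h2).2
  have h5 : ε * |dist y z - dist x z| ≤ ε * s := by gcongr
  have h6 : p * (s + dist y z) ≤ p * (dist x z + s * (ε / p)) := by gcongr
  have h7 : p * (s * (ε / p)) = s * ε := by field_simp
  have h8 : p = c + 3 * ε := by rw [hε]; ring
  have h9 : 0 < s * ε := by positivity
  have h10 : p * s = c * s + 3 * (s * ε) := by rw [h8]; ring
  linarith [h10, mul_add p s (dist y z), mul_add p (dist x z) (s * (ε / p)),
    mul_sub p (dist y z) (dist x z), mul_comm ε s]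

theorem IsRadialProfile.localSlope_eq (hX : IsLengthSpace X) (hg : IsRadialProfile g g')
    (z x : X) : localSlope (fun y => g (dist y z)) x = g' (dist x z) :=
  (hg.localSlope_le z x).antisymm ((hg.le_subSlope hX z x).trans
    (subSlope_le_localSlope isOpen_univ (hg.locallyLipschitzOn z univ) (mem_univ x)))

theorem IsRadialProfile.mem_lowerTestClass (hX : IsLengthSpace X) (hg : IsRadialProfile g g')
    (z : X) (Ω : Set X) : (fun y => g (dist y z)) ∈ LowerTestClass Ω := by
  refine ⟨hg.locallyLipschitzOn z Ω, fun x _ => ?_, ?_⟩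
  · exact (subSlope_le_localSlope isOpen_univ (hg.locallyLipschitzOn z univ) (mem_univ x)).antisymm
      ((hg.localSlope_le z x).trans (hg.le_subSlope hX z x))
  · rw [funext (hg.localSlope_eq hX z)]
    exact hg.continuousOn.comp (by fun_prop) fun x _ => dist_nonneg

/-- The smoothed cone `K t² / (t + ε) + A t²`, with slope close to `K + 2 A t` away from `0`. -/
theorem isRadialProfile_smoothCone {K A ε : ℝ} (hK : 0 ≤ K) (hA : 0 ≤ A) (hε : 0 < ε) :
    IsRadialProfile (fun t => K * (t ^ 2 / (t + ε)) + A * t ^ 2)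
      (fun t => K * (1 - (ε / (t + ε)) ^ 2) + 2 * A * t) where
  hasDerivAt t ht := by
    have h0 : t + ε ≠ 0 := by positivity
    have h1 := ((hasDerivAt_pow 2 t).div ((hasDerivAt_id t).add_const ε) h0).const_mul K
    have h2 := (hasDerivAt_pow 2 t).const_mul A
    refine (h1.add h2).congr_deriv ?_
    simp
    field_simp
    ring
  continuousOn := by
    have : ∀ t ∈ Ici (0 : ℝ), t + ε ≠ 0 := fun t ht => by
      have := mem_Ici.1 ht; positivity
    fun_prop (disch := assumption)
  nonneg t ht := by
    have h1 : ε / (t + ε) ≤ 1 := by rw [div_le_one (by positivity)]; linarith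
    have h2 : (ε / (t + ε)) ^ 2 ≤ 1 := pow_le_one₀ (by positivity) h1
    have := mul_nonneg hK (sub_nonneg.2 h2)
    positivity
  zero := by simp [hε.ne']

end Length

/-! ### Contact points and cone estimates. -/

section SSolution

variable {X : Type*} [MetricSpace X] {Ω : Set X} {H : X → ℝ → ℝ → ℝ} {u : X → ℝ}
  {g g' : ℝ → ℝ} {x₀ z : X} {r η : ℝ}

theorem localSlopeEnvelope_mul_dist_le (x : X) (hη : 0 ≤ η) :
    localSlopeEnvelope (fun y => η * dist y z) x ≤ η := by
  refine real_limsup_le (fun _ => localSlope_nonneg _ _) hη (Eventually.of_forall fun y => ?_)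
  refine localSlope_le hη (Eventually.of_forall fun w => ?_)
  rw [← mul_sub, abs_mul, abs_of_nonneg hη, dist_comm y w]
  gcongr
  exact abs_dist_sub_le w y z

theorem locallyLipschitzOn_mul_dist (hη : 0 ≤ η) :
    LocallyLipschitzOn Ω fun y => η * dist y z := by
  refine locallyLipschitzOn_of_ball fun x _ => ⟨η, hη, 1, one_pos, fun y _ w _ => ?_⟩
  rw [← mul_sub, abs_mul, abs_of_nonneg hη]
  gcongr
  exact abs_dist_sub_le y w z

/-- A radial test function whose values on the sphere are large is touched, up to a small cone,
at an interior point, where the subsolution inequality holds. -/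
theorem exists_subsolution_point [CompleteSpace X] (hX : IsLengthSpace X)
    (hH : ∀ x ∈ Ω, ∀ ρ, MonotoneOn (H x ρ) (Ici 0)) (huc : ContinuousOn u Ω)
    (hu : IsSSubsolution Ω H u) (hg : IsRadialProfile g g') (hball : Metric.closedBall z r ⊆ Ω)
    {M : ℝ} (hM : ∀ w ∈ Metric.closedBall z r, u w ≤ M) {y : X} (hy : y ∈ Metric.closedBall z r)
    (hgr : M - g r < u y - g (dist y z)) (hη : 0 < η) :
    ∃ x ∈ Metric.ball z r, u y - g (dist y z) ≤ u x - g (dist x z) ∧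
      H x (u x) (max (g' (dist x z) - η) 0) ≤ 0 := by
  have hr : 0 ≤ r := dist_nonneg.trans hy
  have hcont : ContinuousOn (fun w => g (dist w z) - u w) (Metric.closedBall z r) :=
    ((hg.locallyLipschitzOn z Ω).continuousOn.sub huc).mono hball
  obtain ⟨x, hx, hxy, hmin⟩ := exists_ekeland_min Metric.isClosed_closedBall hcont (m := g 0 - M)
    (fun w hw => by linarith [hM w hw, hg.le_apply_dist w z]) hy hη
  have hxr : x ∈ Metric.ball z r := by
    refine lt_of_le_of_ne (Metric.mem_closedBall.1 hx) fun h => ?_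
    rw [h] at hxy
    linarith [hM x hx]
  have hxΩ := hball hx
  refine ⟨x, hxr, by linarith, ?_⟩
  have h := hu.2 _ (hg.mem_lowerTestClass hX z Ω) _ (locallyLipschitzOn_mul_dist (z := x) hη.le) x hxΩ
    (by
      filter_upwards [Metric.isOpen_ball.mem_nhds hxr] with w hw
      have := hmin w (Metric.ball_subset_closedBall hw)
      simp only [dist_self]
      linarith)
  have hp : 0 ≤ g' (dist x z) := hg.nonneg _ dist_nonneg
  rw [hg.localSlope_eq hX, lowerRelax_nonpos_iff (hH x hxΩ _) (localSlopeEnvelope_nonneg _ _) hp] at h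
  refine (hH x hxΩ _ (mem_Ici.2 (le_max_right _ _)) (mem_Ici.2 (le_max_right _ _)) ?_).trans h
  exact max_le_max_right _ (by linarith [localSlopeEnvelope_mul_dist_le (z := x) x hη.le])

theorem exists_supersolution_point [CompleteSpace X] (hX : IsLengthSpace X)
    (hH : ∀ x ∈ Ω, ∀ ρ, MonotoneOn (H x ρ) (Ici 0)) (huc : ContinuousOn u Ω)
    (hu : IsSSupersolution Ω H u) (hg : IsRadialProfile g g') (hball : Metric.closedBall z r ⊆ Ω)
    {m : ℝ} (hm : ∀ w ∈ Metric.closedBall z r, m ≤ u w) {y : X} (hy : y ∈ Metric.closedBall z r)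
    (hgr : u y + g (dist y z) < m + g r) (hη : 0 < η) :
    ∃ x ∈ Metric.ball z r, 0 ≤ H x (u x) (g' (dist x z) + η) := by
  have hr : 0 ≤ r := dist_nonneg.trans hy
  have hcont : ContinuousOn (fun w => u w + g (dist w z)) (Metric.closedBall z r) :=
    (huc.add (hg.locallyLipschitzOn z Ω).continuousOn).mono hball
  obtain ⟨x, hx, hxy, hmin⟩ := exists_ekeland_min Metric.isClosed_closedBall hcont (m := m + g 0)
    (fun w hw => by linarith [hm w hw, hg.le_apply_dist w z]) hy hη
  have hxr : x ∈ Metric.ball z r := by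
    refine lt_of_le_of_ne (Metric.mem_closedBall.1 hx) fun h => ?_
    rw [h] at hxy
    linarith [hm x hx]
  have hxΩ := hball hx
  refine ⟨x, hxr, ?_⟩
  have hneg : LocallyLipschitzOn Ω fun y => -(η * dist y x) :=
    (locallyLipschitzOn_mul_dist hη.le).neg
  have h := hu.2 _ (neg_mem_upperTestClass (hg.mem_lowerTestClass hX z Ω)) _ hneg x hxΩ
    (by
      filter_upwards [Metric.isOpen_ball.mem_nhds hxr] with w hw
      have := hmin w (Metric.ball_subset_closedBall hw)
      simp only [dist_self]
      linarith)
  have henv : localSlopeEnvelope (fun y => -(η * dist y x)) x ≤ η := by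
    rw [localSlopeEnvelope, localSlope_neg]
    exact localSlopeEnvelope_mul_dist_le x hη.le
  have hp : 0 ≤ g' (dist x z) := hg.nonneg _ dist_nonneg
  have henv0 := localSlopeEnvelope_nonneg (fun y => -(η * dist y x)) x
  rw [localSlope_neg, hg.localSlope_eq hX, upperRelax_nonneg_iff (hH x hxΩ _) henv0 hp] at h
  exact h.trans (hH x hxΩ _ (mem_Ici.2 (by positivity)) (mem_Ici.2 (by positivity)) (by linarith))

/-- The quadratic term beats `u` on the sphere. The smoothed cone lies below the true one, so a
violation by `θ` at `y` yields a contact point `x` with `u x - u z ≥ θ`. Continuity keeps `x` away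
from `z`, where the smoothed cone is steep enough to contradict `hpos`. -/
theorem le_cone_of_subsolution [CompleteSpace X] (hX : IsLengthSpace X)
    (hH : ∀ x ∈ Ω, ∀ ρ, MonotoneOn (H x ρ) (Ici 0)) (huc : ContinuousOn u Ω)
    (hu : IsSSubsolution Ω H u) (hball : Metric.closedBall z r ⊆ Ω) (hr : 0 < r)
    {M A P K : ℝ} (hM : ∀ w ∈ Metric.closedBall z r, u w ≤ M) (hA : 0 ≤ A)
    (hMA : M - A * r ^ 2 ≤ u z) (hP : 0 ≤ P) (hPK : P < K)
    (hpos : ∀ x ∈ Metric.ball z r, 0 < H x (u x) P) {y : X} (hy : y ∈ Metric.closedBall z r) :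
    u y - u z ≤ K * dist y z + A * dist y z ^ 2 := by
  by_contra! hlt
  set θ := u y - u z - (K * dist y z + A * dist y z ^ 2) with hθ
  have hθ0 : 0 < θ := by rw [hθ]; linarith
  have hK : 0 < K := hP.trans_lt hPK
  have huz : ContinuousWithinAt u Ω z := huc z (hball (Metric.mem_closedBall_self hr.le))
  obtain ⟨δ, hδ, hδu⟩ := Metric.continuousWithinAt_iff.1 huz θ hθ0
  -- Beyond distance `δ` smoothing costs at most `(K - P) / 2` of slope; the Ekeland penalty costs
  -- the other half.
  set ε := δ * ((K - P) / (2 * K)) with hε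
  have hKP : 0 < K - P := sub_pos.2 hPK
  have hε0 : 0 < ε := by positivity
  have hg := isRadialProfile_smoothCone hK.le hA hε0
  have hle : ∀ t, 0 ≤ t → t ^ 2 / (t + ε) ≤ t := fun t ht => by
    rw [div_le_iff₀ (by positivity)]; nlinarith
  obtain ⟨x, hx, hxy, hHx⟩ := exists_subsolution_point hX hH huc hu hg hball hM hy
    (by
      have h1 := mul_le_mul_of_nonneg_left (hle _ (dist_nonneg (x := y) (y := z))) hK.le
      have h2 : 0 ≤ K * (r ^ 2 / (r + ε)) := by positivity
      linarith) (half_pos hKP)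
  have hxΩ := hball (Metric.ball_subset_closedBall hx)
  have hd : δ ≤ dist x z := by
    by_contra! hd
    have h1 := (abs_lt.1 (hδu hxΩ hd)).2
    have h2 := mul_le_mul_of_nonneg_left (hle _ (dist_nonneg (x := y) (y := z))) hK.le
    have h3 : 0 ≤ K * (dist x z ^ 2 / (dist x z + ε)) + A * dist x z ^ 2 := by positivity
    linarith
  have hε1 : (ε / (dist x z + ε)) ^ 2 ≤ (K - P) / (2 * K) := by
    have h1 : ε / (dist x z + ε) ≤ 1 := by
      rw [div_le_one (by positivity)]; linarith [dist_nonneg (x := x) (y := z)]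
    have h2 : ε / (dist x z + ε) ≤ ε / δ := by gcongr; linarith
    have h3 : ε / δ = (K - P) / (2 * K) := by rw [hε]; field_simp
    have h4 : 0 ≤ ε / (dist x z + ε) := by positivity
    nlinarith
  have hslope : P ≤ K * (1 - (ε / (dist x z + ε)) ^ 2) + 2 * A * dist x z - (K - P) / 2 := by
    have h1 := mul_le_mul_of_nonneg_left hε1 hK.le
    have h2 : K * ((K - P) / (2 * K)) = (K - P) / 2 := by field_simp
    have h3 : 0 ≤ 2 * A * dist x z := by positivity
    linarith
  have := hH x hxΩ (u x) (mem_Ici.2 hP) (mem_Ici.2 (le_max_right _ _))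
    (hslope.trans (le_max_left _ 0))
  linarith [hpos x hx]

theorem exists_closedBall_of_continuousOn (hΩ : IsOpen Ω) (huc : ContinuousOn u Ω)
    (hx₀ : x₀ ∈ Ω) {p : X → Prop} (hp : ∀ᶠ x in 𝓝 x₀, p x) :
    ∃ r > 0, ∀ x ∈ Metric.closedBall x₀ r, x ∈ Ω ∧ |u x - u x₀| ≤ 1 ∧ p x := by
  have hu : ∀ᶠ x in 𝓝 x₀, |u x - u x₀| ≤ 1 := by
    have := (huc.continuousAt (hΩ.mem_nhds hx₀)).eventually (Metric.closedBall_mem_nhds _ one_pos)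
    exact this
  obtain ⟨r, hr, h⟩ := Metric.nhds_basis_closedBall.eventually_iff.1
    (Filter.Eventually.and (p := (· ∈ Ω)) (hΩ.mem_nhds hx₀) (hu.and hp))
  exact ⟨r, hr, fun x hx => h hx⟩

theorem exists_cone_estimate [CompleteSpace X] (hX : IsLengthSpace X) (hΩ : IsOpen Ω)
    (hH : ∀ x ∈ Ω, ∀ ρ, MonotoneOn (H x ρ) (Ici 0)) (huc : ContinuousOn u Ω)
    (hu : IsSSubsolution Ω H u) (hx₀ : x₀ ∈ Ω) {P K : ℝ} (hP : 0 ≤ P) (hPK : P < K)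
    (hpos : ∀ᶠ x in 𝓝 x₀, 0 < H x (u x) P) :
    ∃ A ≥ 0, ∃ s > 0, ∀ y ∈ Metric.ball x₀ s, ∀ z ∈ Metric.ball x₀ s,
      u y - u z ≤ K * dist y z + A * dist y z ^ 2 := by
  obtain ⟨r, hr, h⟩ := exists_closedBall_of_continuousOn hΩ huc hx₀ hpos
  -- On the large ball `u` oscillates by at most `2`, which `A (r / 2) ^ 2 = 2` absorbs for every
  -- centre `z`.
  refine ⟨2 / (r / 2) ^ 2, by positivity, r / 4, by positivity, fun y hy z hz => ?_⟩
  rw [Metric.mem_ball] at hy hz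
  have hsub : Metric.closedBall z (r / 2) ⊆ Metric.closedBall x₀ r := fun w hw => by
    rw [Metric.mem_closedBall] at *
    linarith [dist_triangle w z x₀]
  have hz' : z ∈ Metric.closedBall x₀ r := by rw [Metric.mem_closedBall]; linarith
  refine le_cone_of_subsolution hX hH huc hu (fun w hw => (h w (hsub hw)).1) (half_pos hr)
    (M := u x₀ + 1) (fun w hw => ?_) (by positivity) ?_ hP hPK
    (fun w hw => (h w (hsub (Metric.ball_subset_closedBall hw))).2.2) ?_
  · linarith [(abs_le.1 (h w (hsub hw)).2.1).2]
  · rw [div_mul_cancel₀ _ (by positivity)]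
    linarith [(abs_le.1 (h z hz').2.1).1]
  · rw [Metric.mem_closedBall]
    linarith [dist_triangle_right y z x₀]

theorem IsSSubsolution.locallyLipschitzOn [CompleteSpace X] (hX : IsLengthSpace X)
    (hΩ : IsOpen Ω) (hH : ∀ x ∈ Ω, ∀ ρ, MonotoneOn (H x ρ) (Ici 0)) (huc : ContinuousOn u Ω)
    (hu : IsSSubsolution Ω H u)
    (hcoer : ∀ R > 0, ∃ P ≥ 0, ∀ x ∈ Ω, ∀ ρ ∈ Icc (-R) R, 0 < H x ρ P) :
    LocallyLipschitzOn Ω u := by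
  refine locallyLipschitzOn_of_ball fun x₀ hx₀ => ?_
  obtain ⟨P, hP, hpos⟩ := hcoer (|u x₀| + 1) (by positivity)
  obtain ⟨r, hr, h⟩ := exists_closedBall_of_continuousOn hΩ huc hx₀
    (p := fun _ => True) (Eventually.of_forall fun _ => trivial)
  obtain ⟨A, hA, s, hs, hest⟩ := exists_cone_estimate hX hΩ hH huc hu hx₀ hP (lt_add_one P) (by
    filter_upwards [Metric.closedBall_mem_nhds x₀ hr] with x hx
    refine hpos x (h x hx).1 _ ?_
    refine abs_le.1 ?_
    linarith [abs_sub_abs_le_abs_sub (u x) (u x₀), (h x hx).2.1])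
  have key : ∀ y ∈ Metric.ball x₀ s, ∀ z ∈ Metric.ball x₀ s,
      u y - u z ≤ (P + 1 + A * (2 * s)) * dist y z := fun y hy z hz => by
    have h1 := hest y hy z hz
    have h2 : dist y z ≤ 2 * s := by
      rw [Metric.mem_ball] at hy hz
      linarith [dist_triangle_right y z x₀]
    have h3 : A * dist y z * dist y z ≤ A * (2 * s) * dist y z := by gcongr
    linarith
  refine ⟨P + 1 + A * (2 * s), by positivity, s, hs, fun y hy z hz => abs_le.2 ⟨?_, key y hy z hz⟩⟩
  have := key z hz y hy
  rw [dist_comm] at this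
  linarith

/-! ### From s-solutions to Monge solutions. -/

theorem continuousAt_hamiltonian (hΩ : IsOpen Ω)
    (hcont : ContinuousOn (fun z : X × ℝ × ℝ => H z.1 z.2.1 z.2.2) (Ω ×ˢ (univ ×ˢ Ici 0)))
    (huc : ContinuousOn u Ω) (hx₀ : x₀ ∈ Ω) {P : ℝ} (hP : 0 ≤ P) :
    ContinuousAt (fun x => H x (u x) P) x₀ :=
  (hcont.comp (f := fun x => (x, u x, P)) (by fun_prop)
    fun x hx => ⟨hx, mem_univ _, hP⟩).continuousAt (hΩ.mem_nhds hx₀)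

theorem continuousOn_hamiltonian_slope
    (hcont : ContinuousOn (fun z : X × ℝ × ℝ => H z.1 z.2.1 z.2.2) (Ω ×ˢ (univ ×ˢ Ici 0)))
    (hx₀ : x₀ ∈ Ω) (ρ : ℝ) : ContinuousOn (H x₀ ρ) (Ici 0) :=
  hcont.comp (f := fun p => (x₀, ρ, p)) (by fun_prop) fun _ hp => ⟨hx₀, mem_univ _, hp⟩

theorem IsSSubsolution.isMongeSubsolution [CompleteSpace X] (hX : IsLengthSpace X)
    (hΩ : IsOpen Ω) (hH : ∀ x ∈ Ω, ∀ ρ, MonotoneOn (H x ρ) (Ici 0))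
    (hcont : ContinuousOn (fun z : X × ℝ × ℝ => H z.1 z.2.1 z.2.2) (Ω ×ˢ (univ ×ˢ Ici 0)))
    (hu : IsSSubsolution Ω H u) (hlip : LocallyLipschitzOn Ω u) : IsMongeSubsolution Ω H u := by
  refine ⟨hlip, fun x₀ hx₀ => ?_⟩
  have huc := hlip.continuousOn
  by_contra! hlt
  -- At zero sub-slope no smaller `P ≥ 0` exists; a parabola gives a contact point instead, and
  -- monotonicity lowers the slope there to `0`.
  rcases (subSlope_nonneg u x₀).eq_or_lt with hL | hL
  · rw [← hL] at hlt
    obtain ⟨r, hr, h⟩ := exists_closedBall_of_continuousOn hΩ huc hx₀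
      ((continuousAt_hamiltonian hΩ hcont huc hx₀ le_rfl).eventually (lt_mem_nhds hlt))
    have hg := isRadialProfile_smoothCone (K := 0) (A := 2 / r ^ 2) le_rfl (by positivity) one_pos
    obtain ⟨x, hx, -, hHx⟩ := exists_subsolution_point hX hH huc hu hg (fun w hw => (h w hw).1)
      (M := u x₀ + 1) (fun w hw => by linarith [(abs_le.1 (h w hw).2.1).2])
      (Metric.mem_closedBall_self hr.le)
      (by
        rw [div_mul_cancel₀ _ (by positivity)]
        simp
        linarith) one_pos
    have h1 := h x (Metric.ball_subset_closedBall hx)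
    linarith [h1.2.2, hH x h1.1 (u x) self_mem_Ici (mem_Ici.2 (le_max_right _ _))
      (le_max_right _ 0) |>.trans hHx]
  · have h1 := ((continuousOn_hamiltonian_slope hcont hx₀ (u x₀)).continuousAt
      (Ici_mem_nhds hL)).eventually (lt_mem_nhds hlt)
    obtain ⟨P, ⟨hP1, hP0⟩, hPL⟩ := (((h1.and (lt_mem_nhds hL)).filter_mono
      nhdsWithin_le_nhds).and (self_mem_nhdsWithin (s := Iio (subSlope u x₀)))).exists
    obtain ⟨K, hPK, hKL⟩ := exists_between hPL
    obtain ⟨c, hKc, hcL⟩ := exists_between hKL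
    obtain ⟨A, hA, s, hs, hest⟩ := exists_cone_estimate hX hΩ hH huc hu hx₀ hP0.le hPK
      ((continuousAt_hamiltonian hΩ hcont huc hx₀ hP0.le).eventually (lt_mem_nhds hP1))
    have hlim : ∀ᶠ y in 𝓝 x₀, A * dist x₀ y < c - K := by
      have : Tendsto (fun y => A * dist x₀ y) (𝓝 x₀) (𝓝 (A * dist x₀ x₀)) :=
        Continuous.tendsto (by fun_prop) x₀
      rw [dist_self, mul_zero] at this
      exact this.eventually (gt_mem_nhds (sub_pos.2 hKc))
    refine absurd (subSlope_le (u := u) (x := x₀) ((hP0.trans (hPK.trans hKc)).le) ?_) hcL.not_ge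
    filter_upwards [hlim, Metric.ball_mem_nhds x₀ hs] with y hy hys
    have h2 := hest x₀ (Metric.mem_ball_self hs) y hys
    have h3 := mul_le_mul_of_nonneg_right hy.le (dist_nonneg (x := x₀) (y := y))
    linarith

theorem IsSSupersolution.isMongeSupersolution [CompleteSpace X] (hX : IsLengthSpace X)
    (hΩ : IsOpen Ω) (hH : ∀ x ∈ Ω, ∀ ρ, MonotoneOn (H x ρ) (Ici 0))
    (hcont : ContinuousOn (fun z : X × ℝ × ℝ => H z.1 z.2.1 z.2.2) (Ω ×ˢ (univ ×ˢ Ici 0)))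
    (hu : IsSSupersolution Ω H u) (hlip : LocallyLipschitzOn Ω u) :
    IsMongeSupersolution Ω H u := by
  refine ⟨hlip, fun x₀ hx₀ => ?_⟩
  have huc := hlip.continuousOn
  by_contra! hlt
  have hL := subSlope_nonneg u x₀
  have h1 := ((continuousOn_hamiltonian_slope hcont hx₀ (u x₀) _ hL).mono
    (Ioi_subset_Ici hL)).eventually (gt_mem_nhds hlt)
  obtain ⟨q, hq, hLq⟩ := (h1.and self_mem_nhdsWithin).exists
  obtain ⟨K, hLK, hKq⟩ := exists_between hLq
  obtain ⟨c, hLc, hcK⟩ := exists_between hLK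
  have hc0 : 0 ≤ c := hL.trans hLc.le
  have hK0 : 0 ≤ K := hc0.trans hcK.le
  have hq0 : 0 ≤ q := hK0.trans hKq.le
  obtain ⟨r, hr, h⟩ := exists_closedBall_of_continuousOn hΩ huc hx₀
    (((continuousAt_hamiltonian hΩ hcont huc hx₀ hq0).eventually (gt_mem_nhds hq)).and
      (eventually_of_subSlope_lt hΩ hlip hx₀ hLc))
  have hcK' : 0 < K - c := sub_pos.2 hcK
  -- This gives `c ε < (K - c) r`, so the smoothed cone still exceeds `c r` on the sphere; the `+ 1`
  -- covers `c = 0`.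
  set ε := (K - c) * r / (c + 1) with hε
  have hε0 : 0 < ε := by positivity
  have hg := isRadialProfile_smoothCone (A := 0) hK0 le_rfl hε0
  obtain ⟨x, hx, hHx⟩ := exists_supersolution_point hX hH huc hu hg (fun w hw => (h w hw).1)
    (m := u x₀ - c * r) (fun w hw => by
      have h2 := (h w hw).2.2.2
      have h3 : c * dist x₀ w ≤ c * r := by
        gcongr
        rw [dist_comm]; exact hw
      linarith) (Metric.mem_closedBall_self hr.le)
    (by
      have h2 : c * r < K * (r ^ 2 / (r + ε)) := by
        rw [← mul_div_assoc, lt_div_iff₀ (by positivity)]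
        have h3 : ε * (c + 1) = (K - c) * r := by rw [hε]; field_simp
        have h4 : c * ε < (K - c) * r := by linarith
        nlinarith [mul_lt_mul_of_pos_right h4 hr]
      simp
      linarith) (sub_pos.2 hKq)
  have h2 := h x (Metric.ball_subset_closedBall hx)
  refine absurd (hHx.trans (hH x h2.1 (u x) (mem_Ici.2 ?_) (mem_Ici.2 hq0) ?_)) h2.2.2.1.not_ge
  · have := hg.nonneg (dist x x₀) dist_nonneg
    linarith
  · have : 0 ≤ K * (ε / (dist x x₀ + ε)) ^ 2 := by positivity
    linarith

/-! ### From Monge solutions to s-solutions. -/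

theorem IsMongeSubsolution.isSSubsolution (hΩ : IsOpen Ω)
    (hH : ∀ x ∈ Ω, ∀ ρ, MonotoneOn (H x ρ) (Ici 0)) (hu : IsMongeSubsolution Ω H u) :
    IsSSubsolution Ω H u := by
  refine ⟨hu.1.continuousOn.upperSemicontinuousOn, fun ψ₁ h₁ ψ₂ h₂ x hx hmax => ?_⟩
  rw [lowerRelax_nonpos_iff (hH x hx _) (localSlopeEnvelope_nonneg _ _) (localSlope_nonneg _ _)]
  refine (hH x hx _ (mem_Ici.2 (le_max_right _ _)) (mem_Ici.2 (subSlope_nonneg u x)) ?_).trans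
    (hu.2 x hx)
  refine max_le ?_ (subSlope_nonneg u x)
  rw [← h₁.2.1 x hx]
  linarith [subSlope_le_of_touching_above hΩ hu.1 h₂ hx hmax, localSlope_le_envelope hΩ h₂ hx]

theorem IsMongeSupersolution.isSSupersolution (hΩ : IsOpen Ω)
    (hH : ∀ x ∈ Ω, ∀ ρ, MonotoneOn (H x ρ) (Ici 0)) (hu : IsMongeSupersolution Ω H u) :
    IsSSupersolution Ω H u := by
  refine ⟨hu.1.continuousOn.lowerSemicontinuousOn, fun ψ₁ h₁ ψ₂ h₂ x hx hmin => ?_⟩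
  have h0 := localSlopeEnvelope_nonneg ψ₂ x
  have h1 := localSlope_nonneg ψ₁ x
  rw [upperRelax_nonneg_iff (hH x hx _) h0 h1]
  refine (hu.2 x hx).trans
    (hH x hx _ (mem_Ici.2 (subSlope_nonneg u x)) (mem_Ici.2 (by positivity)) ?_)
  linarith [subSlope_le_of_touching_below hΩ h₁.1 h₂ hx hmin, localSlope_le_envelope hΩ h₂ hx]

end SSolution

end MetricHJ

/-- Functions on `Ω` and on `Ω × ℝ × [0, ∞)` are given by total functions whose values elsewhere
play no role. -/
theorem theorem4p9 {X : Type*} [MetricSpace X] [CompleteSpace X]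
    (hX : MetricHJ.IsLengthSpace X) (Ω : Set X) (hΩ : IsOpen Ω)
    (H : X → ℝ → ℝ → ℝ)
    (hcont : ContinuousOn (fun z : X × ℝ × ℝ => H z.1 z.2.1 z.2.2) (Ω ×ˢ (univ ×ˢ Ici 0)))
    (hunif : ∀ x₀ ∈ Ω, ∀ ρ₀ : ℝ, ∃ δ > 0, ∃ ω : ℝ → ℝ, MetricHJ.IsModulus ω ∧
      ∀ x₁ ∈ Metric.ball x₀ δ ∩ Ω, ∀ x₂ ∈ Metric.ball x₀ δ ∩ Ω,
      ∀ ρ₁ ∈ Icc (ρ₀ - δ) (ρ₀ + δ), ∀ ρ₂ ∈ Icc (ρ₀ - δ) (ρ₀ + δ), ∀ p : ℝ, 0 ≤ p →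
        |H x₁ ρ₁ p - H x₂ ρ₂ p| ≤ ω (dist x₁ x₂ + |ρ₁ - ρ₂|))
    (hmono : ∀ x₀ ∈ Ω, ∀ ρ₀ : ℝ, ∃ δ > 0, ∃ lam > 0,
      ∀ x ∈ Metric.ball x₀ δ ∩ Ω, ∀ ρ ∈ Icc (ρ₀ - δ) (ρ₀ + δ),
        MonotoneOn (fun p : ℝ => H x ρ p - lam * p) (Ici 0))
    (hcoer : ∀ R > 0, Tendsto
      (fun p : ℝ => ⨅ x ∈ Ω, ⨅ ρ ∈ Icc (-R) R, ((H x ρ p : ℝ) : EReal)) atTop (𝓝 ⊤))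
    (u : X → ℝ) :
    (MetricHJ.IsMongeSolution Ω H u ↔
      MetricHJ.LocallyUniformContinuousOn u Ω ∧ MetricHJ.IsSSolution Ω H u) ∧
    (MetricHJ.IsMongeSolution Ω H u ∨
        (MetricHJ.LocallyUniformContinuousOn u Ω ∧ MetricHJ.IsSSolution Ω H u) →
      LocallyLipschitzOn Ω u) := by
  have hH : ∀ x ∈ Ω, ∀ ρ, MonotoneOn (H x ρ) (Ici 0) := fun x hx ρ p hp q hq hpq => by
    obtain ⟨δ, hδ, lam, hlam, h⟩ := hmono x hx ρ
    have h1 := h x ⟨Metric.mem_ball_self hδ, hx⟩ ρ ⟨by linarith, by linarith⟩ hp hq hpq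
    have h2 := mul_le_mul_of_nonneg_left hpq (le_of_lt hlam)
    simp only at h1
    linarith
  have hpos : ∀ R > 0, ∃ P ≥ 0, ∀ x ∈ Ω, ∀ ρ ∈ Icc (-R) R, 0 < H x ρ P := fun R hR => by
    obtain ⟨P, hP, hP0⟩ := (((hcoer R hR).eventually
      (lt_mem_nhds (show (0 : EReal) < ⊤ from EReal.zero_lt_top))).and
        (eventually_ge_atTop 0)).exists
    refine ⟨P, hP0, fun x hx ρ hρ => ?_⟩
    exact EReal.coe_pos.1 (hP.trans_le ((iInf₂_le x hx).trans (iInf₂_le ρ hρ)))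
  have hiff : MetricHJ.IsMongeSolution Ω H u ↔
      MetricHJ.LocallyUniformContinuousOn u Ω ∧ MetricHJ.IsSSolution Ω H u := by
    constructor
    · rintro ⟨h₁, h₂⟩
      exact ⟨MetricHJ.locallyUniformContinuousOn hΩ h₁.1, h₁.1.continuousOn,
        h₁.isSSubsolution hΩ hH, h₂.isSSupersolution hΩ hH⟩
    · rintro ⟨-, huc, h₁, h₂⟩
      have hlip := h₁.locallyLipschitzOn hX hΩ hH huc hpos
      exact ⟨h₁.isMongeSubsolution hX hΩ hH hcont hlip,
        h₂.isMongeSupersolution hX hΩ hH hcont hlip⟩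
  exact ⟨hiff, fun h => (h.elim id hiff.2).1.1⟩
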